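/- \textbf{Theorem} (Murphy; Albert and Atkinson). Every permutation class containing only finitely many simple permutations is finitely based. Here a permutation $\pi$ of length $n$ \emph{contains} a permutation $\sigma$ of length $m$, written $\sigma\le\pi$, if some subsequence of $\pi(1)\pi(2)\cdots\pi(n)$ is order isomorphic to $\sigma(1)\cdots\sigma(m)$. A \emph{permutation class} is a set $\mathcal C$ of (finite) permutations such that $\pi\in\mathcal C$ and $\sigma\le\pi$ imply $\sigma\in\mathcal C$. An \emph{interval} of $\pi$ is a set $I$ of contiguous indices such that $\pi(I)$ is a set of contiguous values, and $\pi$ is \emph{simple} if its only intervals are those of lengths $0$, $1$ and $n$. The \emph{basis} of $\mathcal C$ is the smallest set $B$ of permutations (with respect to inclusion) such that $\mathcal C=\{\pi : \beta\not\le\pi \text{ for all }\beta\in B\}$, and $\mathcal C$ is \emph{finitely based} if its basis exists and is finite. -/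

import Mathlib

/-- A permutation of `{0, …, length - 1}`, of arbitrary finite length. -/
structure Permutation where
  length : ℕ
  toPerm : Equiv.Perm (Fin length)

namespace Permutation

/-- `π.Contains σ`: some subsequence of `π` (picked out by the increasing choice of indices `f`)
is order isomorphic to `σ`. -/
def Contains (π σ : Permutation) : Prop :=
  ∃ f : Fin σ.length → Fin π.length, StrictMono f ∧
    ∀ i j, σ.toPerm i < σ.toPerm j ↔ π.toPerm (f i) < π.toPerm (f j)

theorem contains_antisymm {σ π : Permutation} (h₁ : π.Contains σ) (h₂ : σ.Contains π) :
    σ = π := by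
  obtain ⟨m, σ⟩ := σ
  obtain ⟨n, π⟩ := π
  obtain ⟨f, hf, h⟩ := h₁
  obtain ⟨g, hg, -⟩ := h₂
  dsimp only at f g hf hg h
  obtain rfl : m = n := le_antisymm
    (by simpa using Fintype.card_le_of_injective f hf.injective)
    (by simpa using Fintype.card_le_of_injective g hg.injective)
  have hid : f = id := (StrictMono.range_inj hf strictMono_id).mp
    (by rw [(Finite.injective_iff_surjective.mp hf.injective).range_eq, Set.range_id])
  subst hid
  have hmono : StrictMono (π ∘ σ.symm) := fun a b hab =>
    (h (σ.symm a) (σ.symm b)).mp (by simpa using hab)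
  have hcomp : π ∘ σ.symm = id := (StrictMono.range_inj hmono strictMono_id).mp
    (by rw [(π.surjective.comp σ.symm.surjective).range_eq, Set.range_id])
  have hσπ : σ = π := by
    ext i
    have := congrFun hcomp (σ i)
    simp only [Function.comp_apply, Equiv.symm_apply_apply, id] at this
    rw [this]
  rw [hσπ]

/-- The pattern containment order: `σ ≤ π` if and only if `π` contains `σ`. -/
instance : PartialOrder Permutation where
  le σ π := π.Contains σ
  le_refl _ := ⟨id, strictMono_id, fun _ _ => Iff.rfl⟩
  le_trans _ _ _ := fun ⟨f, hf, h⟩ ⟨g, hg, k⟩ =>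
    ⟨g ∘ f, hg.comp hf, fun i j => (h i j).trans (k (f i) (f j))⟩
  le_antisymm _ _ := contains_antisymm

/-- `I` is a set of contiguous indices whose set of values under `π` is also contiguous
(the empty set is allowed). -/
def IsInterval (π : Permutation) (I : Set (Fin π.length)) : Prop :=
  I.OrdConnected ∧ (π.toPerm '' I).OrdConnected

/-- `π` has no intervals except those of lengths `0`, `1` and `π.length`. -/
def IsSimple (π : Permutation) : Prop :=
  ∀ I : Set (Fin π.length), π.IsInterval I → I.ncard = 0 ∨ I.ncard = 1 ∨ I.ncard = π.length

/-- A permutation class: a downset of permutations under pattern containment. -/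
def IsClass (C : Set Permutation) : Prop :=
  ∀ π ∈ C, ∀ σ, σ ≤ π → σ ∈ C

/-- The set of permutations avoiding every member of `B`. -/
def Av (B : Set Permutation) : Set Permutation :=
  {π | ∀ β ∈ B, ¬ β ≤ π}

/-- `B` is the basis of `C`: the smallest set (for inclusion) with `C = Av B`. -/
def IsBasis (B C : Set Permutation) : Prop :=
  IsLeast {B' : Set Permutation | C = Av B'} B

/-- `C` is finitely based: its basis is finite. -/
def FinitelyBased (C : Set Permutation) : Prop :=
  ∃ B : Set Permutation, IsBasis B C ∧ B.Finite

end Permutation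

/-!
# Permutation classes with finitely many simple permutations are finitely based

Finiteness of the basis is deduced from a well-quasi-order on two-coloured permutations. Let `β` be
a basis element of positive length. Deleting its last entry leaves a permutation in the class, and
colouring every remaining entry by whether it lies below or above the deleted one records the
position at which the deleted value has to be put back. A colour-preserving embedding between two
such coloured permutations therefore extends to an embedding of the original basis elements
(`contains_of_embeds_erasedLast`). As the basis is an antichain, it is finite as soon as the
coloured permutations with underlying permutation in the class are well-quasi-ordered
(`partiallyWellOrderedOn_colouredClass`). In particular no bound is needed on the lengths of the
simple permutations lying in the basis.

The well-quasi-order comes from a minimal bad sequence. Every permutation of length at least two is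
the inflation of a simple permutation of length at least two by proper subpermutations, since a
partition into intervals with the fewest blocks, at least two, has a simple quotient
(`exists_simple_inflation`). In a minimal bad sequence all these blocks come from a
well-quasi-ordered set; the quotients lie in the finite set of simple permutations of the class, so
infinitely many terms share one quotient `σ`, and Dickson's lemma for `σ.length`-tuples yields two
of them whose blocks embed one by one. These embeddings glue (`Inflates.embeds`), contradicting
badness.

Coloured permutations are encoded as finite sets of coloured points of `ℕ × ℕ`, so that a
subpermutation is simply a subset and only the quotients have to be standardized.
-/

namespace Permutation

/-! ### Patterns of point sets -/

/-- `σ` is a pattern of the point set `A`, where the point `p` has index `i p` and value `v p`. -/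
def IsPattern {P : Type*} (i v : P → ℕ) (A : Finset P) (σ : Permutation) : Prop :=
  ∃ e : Fin σ.length → P, (∀ a, e a ∈ A) ∧ (∀ a b, a < b ↔ i (e a) < i (e b)) ∧
    ∀ a b, σ.toPerm a < σ.toPerm b ↔ v (e a) < v (e b)

/-- `A` is the inflation of `σ` whose `a`-th block is the set of points of `A` sent to `a` by
`g`. -/
def Inflates {P : Type*} (i v : P → ℕ) (A : Finset P) (σ : Permutation)
    (g : P → Fin σ.length) : Prop :=
  (∀ a, ∃ x ∈ A, g x = a) ∧ ∀ x ∈ A, ∀ y ∈ A, g x ≠ g y →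
    (i x < i y ↔ g x < g y) ∧ (v x < v y ↔ σ.toPerm (g x) < σ.toPerm (g y))

theorem injective_of_lt_iff {α β P : Type*} [LinearOrder α] [Preorder β] {e : α → P} {i : P → β}
    (h : ∀ a b, a < b ↔ i (e a) < i (e b)) : Function.Injective e := fun a b hab =>
  le_antisymm (not_lt.1 (by rw [h, hab]; exact lt_irrefl _))
    (not_lt.1 (by rw [h, hab]; exact lt_irrefl _))

/-- A point set in general position is order isomorphic to a permutation `σ`; its points are
enumerated by `e` from left to right. -/
theorem exists_standardization {P : Type*} {i v : P → ℕ} {A : Finset P}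
    (hi : Set.InjOn i A) (hv : Set.InjOn v A) :
    ∃ (σ : Permutation) (e : Fin σ.length → P), σ.length = A.card ∧ (∀ a, e a ∈ A) ∧
      (∀ p ∈ A, ∃ a, e a = p) ∧ (∀ a b, a < b ↔ i (e a) < i (e b)) ∧
      ∀ a b, σ.toPerm a < σ.toPerm b ↔ v (e a) < v (e b) := by
  classical
  let eI := (A.image i).orderIsoOfFin (Finset.card_image_of_injOn hi)
  let eV := (A.image v).orderIsoOfFin (Finset.card_image_of_injOn hv)
  have hex : ∀ a, ∃ p ∈ A, i p = eI a := fun a => Finset.mem_image.1 (eI a).2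
  choose e heA hie using hex
  have hmono : ∀ a b, a < b ↔ i (e a) < i (e b) := fun a b => by
    rw [hie, hie, Subtype.coe_lt_coe, OrderIso.lt_iff_lt]
  have hinj : Function.Injective e := fun a b h =>
    eI.injective (Subtype.ext (by rw [← hie, ← hie, h]))
  let f : Fin A.card → Fin A.card := fun a =>
    eV.symm ⟨v (e a), Finset.mem_image_of_mem v (heA a)⟩
  have hf : Function.Injective f := fun a b h =>
    hinj (hv (heA a) (heA b) (congrArg Subtype.val (eV.symm.injective h)))
  refine ⟨⟨A.card, Equiv.ofBijective f (Finite.injective_iff_bijective.1 hf)⟩, e, rfl, heA,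
    fun p hp => ?_, hmono, fun a b => ?_⟩
  · refine ⟨eI.symm ⟨i p, Finset.mem_image_of_mem i hp⟩, hi (heA _) hp ?_⟩
    rw [hie, OrderIso.apply_symm_apply]
  · change f a < f b ↔ _
    simp only [f, OrderIso.lt_iff_lt, Subtype.mk_lt_mk]

theorem Inflates.isPattern {P : Type*} {i v : P → ℕ} {A : Finset P} {σ : Permutation}
    {g : P → Fin σ.length} (h : Inflates i v A σ g) : IsPattern i v A σ := by
  choose e heA hge using h.1
  have key : ∀ a b, (a < b ↔ i (e a) < i (e b)) ∧
      (σ.toPerm a < σ.toPerm b ↔ v (e a) < v (e b)) := fun a b => by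
    by_cases hab : a = b
    · simp [hab]
    · have := h.2 _ (heA a) _ (heA b) (by rwa [hge, hge])
      rw [hge, hge] at this
      exact ⟨this.1.symm, this.2.symm⟩
  exact ⟨e, heA, fun a b => (key a b).1, fun a b => (key a b).2⟩

/-! ### Decomposition over a simple quotient -/

theorem _root_.Set.OrdConnected.lt_iff_lt_of_notMem {α : Type*} [LinearOrder α] {S : Set α}
    (hS : S.OrdConnected) {a b k : α} (ha : a ∈ S) (hb : b ∈ S) (hk : k ∉ S) :
    (a < k ↔ b < k) ∧ (k < a ↔ k < b) := by
  refine ⟨⟨fun h => ?_, fun h => ?_⟩, ⟨fun h => ?_, fun h => ?_⟩⟩ <;> by_contra! h'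
  · exact hk (hS.out ha hb ⟨h.le, h'⟩)
  · exact hk (hS.out hb ha ⟨h.le, h'⟩)
  · exact hk (hS.out hb ha ⟨h', h.le⟩)
  · exact hk (hS.out ha hb ⟨h', h.le⟩)

/-- Contracting an interval to a point: a permutation that is not simple is an inflation of a
shorter permutation of length at least two. -/
theorem exists_contraction {σ : Permutation} (hσ : ¬ σ.IsSimple) :
    ∃ (τ : Permutation) (h : Fin σ.length → Fin τ.length), 2 ≤ τ.length ∧ τ.length < σ.length ∧
      Function.Surjective h ∧ ∀ j k, h j ≠ h k →
        (j < k ↔ h j < h k) ∧ (σ.toPerm j < σ.toPerm k ↔ τ.toPerm (h j) < τ.toPerm (h k)) := by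
  classical
  unfold IsSimple at hσ
  push Not at hσ
  obtain ⟨I, hI, h0, h1, hlen⟩ := hσ
  obtain ⟨i₀, i₁, hi₀, hi₁, hne⟩ := (Set.one_lt_ncard_iff (Set.toFinite I)).1 (by omega)
  obtain ⟨k₀, hk₀⟩ : ∃ k, k ∉ I := by
    by_contra! hall
    rw [Set.eq_univ_of_forall hall, Set.ncard_univ, Nat.card_eq_fintype_card,
      Fintype.card_fin] at hlen
    exact hlen rfl
  -- The chosen `i₀` represents the whole interval `I`.
  let T : Finset (Fin σ.length) := Finset.univ.filter fun j => j ∉ I ∨ j = i₀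
  obtain ⟨τ, e, hcard, heT, hsurj, hei, hev⟩ := exists_standardization
    (i := fun j : Fin σ.length => (j : ℕ)) (v := fun j => (σ.toPerm j : ℕ)) (A := T)
    (fun a _ b _ h => Fin.ext h) (fun a _ b _ h => σ.toPerm.injective (Fin.ext h))
  simp only [Fin.val_fin_lt] at hei hev
  let c : Fin σ.length → Fin σ.length := fun j => if j ∈ I then i₀ else j
  have hcT : ∀ j, c j ∈ T := fun j => by
    by_cases hj : j ∈ I <;> simp [c, T, hj]
  choose h hh using fun j => hsurj (c j) (hcT j)
  have hc : ∀ j k, c j ≠ c k →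
      (j < k ↔ c j < c k) ∧ (σ.toPerm j < σ.toPerm k ↔ σ.toPerm (c j) < σ.toPerm (c k)) := by
    intro j k hjk
    have hmem : ∀ j, σ.toPerm j ∈ σ.toPerm '' I ↔ j ∈ I := fun j =>
      σ.toPerm.injective.mem_set_image
    by_cases hj : j ∈ I <;> by_cases hk : k ∈ I <;> simp only [c, hj, hk, if_true, if_false]
    · simp [c, hj, hk] at hjk
    · exact ⟨(hI.1.lt_iff_lt_of_notMem hj hi₀ hk).1, (hI.2.lt_iff_lt_of_notMem
        ((hmem _).2 hj) ((hmem _).2 hi₀) (mt (hmem _).1 hk)).1⟩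
    · exact ⟨(hI.1.lt_iff_lt_of_notMem hk hi₀ hj).2, (hI.2.lt_iff_lt_of_notMem
        ((hmem _).2 hk) ((hmem _).2 hi₀) (mt (hmem _).1 hj)).2⟩
    · simp
  refine ⟨τ, h, ?_, ?_, fun a => ⟨e a, ?_⟩, fun j k hjk => ?_⟩
  · rw [hcard]
    refine Finset.one_lt_card.2 ⟨i₀, by simp [T], k₀, by simp [T, hk₀], ?_⟩
    rintro rfl
    exact hk₀ hi₀
  · rw [hcard]
    refine (Finset.card_lt_univ_of_notMem (x := i₁) ?_).trans_eq (Fintype.card_fin _)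
    simp [T, hi₁, hne.symm]
  · have hinj : Function.Injective e := fun a b hab =>
      le_antisymm (not_lt.1 (by rw [hei, hab]; exact lt_irrefl _))
        (not_lt.1 (by rw [hei, hab]; exact lt_irrefl _))
    apply hinj
    rw [hh]
    have := heT a
    simp only [T, Finset.mem_filter, Finset.mem_univ, true_and] at this
    rcases this with h' | h' <;> simp [c, h']
  · have hne' : c j ≠ c k := fun hcjk => hjk <| by
      refine le_antisymm (not_lt.1 ?_) (not_lt.1 ?_) <;>
        (rw [hei, hh, hh, hcjk]; exact lt_irrefl _)
    rw [hei, hev, hh, hh]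
    exact hc j k hne'

/-- Every nonempty point set in general position is an inflation of a simple permutation; the
blocks are proper subsets except when there is only one point. -/
theorem exists_simple_inflation {P : Type*} [DecidableEq P] {i v : P → ℕ} {A : Finset P}
    (hi : Set.InjOn i A) (hv : Set.InjOn v A) (hA : A.Nonempty) :
    ∃ (σ : Permutation) (g : P → Fin σ.length), σ.IsSimple ∧ Inflates i v A σ g ∧
      ∀ a, (A.filter fun x => g x = a) ⊂ A ∨ A.card ≤ 1 := by
  classical
  have hstd : ∃ (σ : Permutation) (g : P → Fin σ.length), σ.length = A.card ∧
      Inflates i v A σ g := by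
    obtain ⟨σ, e, hcard, heA, hsurj, hei, hev⟩ := exists_standardization hi hv
    have : Nonempty (Fin σ.length) := ⟨⟨0, by rw [hcard]; exact hA.card_pos⟩⟩
    have hinj : Function.Injective e := injective_of_lt_iff hei
    refine ⟨σ, Function.invFun e, hcard, fun a => ⟨e a, heA a, Function.leftInverse_invFun hinj a⟩,
      fun x hx y hy _ => ?_⟩
    rw [hei, hev, Function.invFun_eq (hsurj x hx), Function.invFun_eq (hsurj y hy)]
    exact ⟨Iff.rfl, Iff.rfl⟩
  by_cases hcard : A.card ≤ 1
  · obtain ⟨σ, g, hσ, hg⟩ := hstd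
    refine ⟨σ, g, fun I _ => ?_, hg, fun _ => Or.inr hcard⟩
    have := Set.ncard_le_card I
    rw [Nat.card_eq_fintype_card, Fintype.card_fin] at this
    omega
  · -- An inflation with the fewest blocks, subject to having at least two.
    have hex : ∃ m, 2 ≤ m ∧ ∃ (σ : Permutation) (g : P → Fin σ.length), σ.length = m ∧
        Inflates i v A σ g := ⟨A.card, by omega, hstd⟩
    obtain ⟨h2, σ, g, hσ, hg⟩ := Nat.find_spec hex
    refine ⟨σ, g, ?_, hg, fun a => Or.inl ?_⟩
    · by_contra hns
      obtain ⟨τ, h, hτ2, hτ, hsurj, hh⟩ := exists_contraction hns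
      refine Nat.find_min hex (hσ ▸ hτ) ⟨hτ2, τ, h ∘ g, rfl, fun a => ?_,
        fun x hx y hy hxy => ?_⟩
      · obtain ⟨b, rfl⟩ := hsurj a
        obtain ⟨x, hx, rfl⟩ := hg.1 b
        exact ⟨x, hx, rfl⟩
      · have h₁ := hg.2 x hx y hy fun h' => hxy (congrArg h h')
        have h₂ := hh _ _ hxy
        exact ⟨h₁.1.trans h₂.1, h₁.2.trans h₂.2⟩
    · have : Nontrivial (Fin σ.length) := Fin.nontrivial_iff_two_le.2 (hσ ▸ h2)
      obtain ⟨b, hb⟩ := exists_ne a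
      obtain ⟨x, hx, rfl⟩ := hg.1 b
      exact Finset.filter_ssubset.2 ⟨x, hx, hb⟩

/-! ### Well-quasi-order of coloured permutations -/

/-- A point with an index, a value and one of two colours. -/
abbrev Point := ℕ × ℕ × Bool

/-- The index of a coloured point. -/
def Point.index (p : Point) : ℕ := p.1

/-- The value of a coloured point. -/
def Point.value (p : Point) : ℕ := p.2.1

/-- The colour of a coloured point. -/
def Point.colour (p : Point) : Bool := p.2.2

/-- Containment of coloured permutations: a map from `A` to `B` preserving and reflecting the order
of indices and of values, and preserving colours. Values of the map outside `A` are irrelevant. -/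
def Embeds (A B : Finset Point) : Prop :=
  ∃ φ : Point → Point, (∀ x ∈ A, φ x ∈ B ∧ (φ x).colour = x.colour) ∧
    ∀ x ∈ A, ∀ y ∈ A, (x.index < y.index ↔ (φ x).index < (φ y).index) ∧
      (x.value < y.value ↔ (φ x).value < (φ y).value)

instance : IsPreorder (Finset Point) Embeds where
  refl _ := ⟨id, fun _ hx => ⟨hx, rfl⟩, fun _ _ _ _ => ⟨Iff.rfl, Iff.rfl⟩⟩
  trans _ _ _ := fun ⟨φ, h₁, h₂⟩ ⟨ψ, k₁, k₂⟩ =>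
    ⟨ψ ∘ φ, fun x hx => ⟨(k₁ _ (h₁ x hx).1).1, (k₁ _ (h₁ x hx).1).2.trans (h₁ x hx).2⟩,
      fun x hx y hy =>
        ⟨(h₂ x hx y hy).1.trans (k₂ _ (h₁ x hx).1 _ (h₁ y hy).1).1,
          (h₂ x hx y hy).2.trans (k₂ _ (h₁ x hx).1 _ (h₁ y hy).1).2⟩⟩

theorem embeds_of_subset {A B : Finset Point} (h : A ⊆ B) : Embeds A B :=
  ⟨id, fun _ hx => ⟨h hx, rfl⟩, fun _ _ _ _ => ⟨Iff.rfl, Iff.rfl⟩⟩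

/-- The coloured permutations whose underlying permutation belongs to `C`: finite sets of points
with distinct indices and distinct values, all of whose patterns are in `C`. -/
def colouredClass (C : Set Permutation) : Set (Finset Point) :=
  {A | Set.InjOn Point.index A ∧ Set.InjOn Point.value A ∧
    ∀ σ, IsPattern Point.index Point.value A σ → σ ∈ C}

theorem colouredClass_of_subset {C : Set Permutation} {A B : Finset Point}
    (hB : B ∈ colouredClass C) (h : A ⊆ B) : A ∈ colouredClass C :=
  ⟨hB.1.mono (by exact_mod_cast h), hB.2.1.mono (by exact_mod_cast h),
    fun σ ⟨e, he, he'⟩ => hB.2.2 σ ⟨e, fun a => h (he a), he'⟩⟩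

/-- Inflations of the same permutation embed in each other as soon as their blocks do. -/
theorem Inflates.embeds {A B : Finset Point} {σ : Permutation} {g h : Point → Fin σ.length}
    (hg : Inflates Point.index Point.value A σ g) (hh : Inflates Point.index Point.value B σ h)
    (hblocks : ∀ a, Embeds (A.filter fun x => g x = a) (B.filter fun x => h x = a)) :
    Embeds A B := by
  choose φ hφ₁ hφ₂ using hblocks
  have hmem : ∀ x ∈ A, φ (g x) x ∈ B ∧ h (φ (g x) x) = g x := fun x hx =>
    Finset.mem_filter.1 (hφ₁ (g x) x (Finset.mem_filter.2 ⟨hx, rfl⟩)).1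
  refine ⟨fun x => φ (g x) x, fun x hx => ⟨(hmem x hx).1,
    (hφ₁ (g x) x (Finset.mem_filter.2 ⟨hx, rfl⟩)).2⟩, fun x hx y hy => ?_⟩
  by_cases hxy : g x = g y
  · simp only [hxy]
    exact hφ₂ (g y) x (Finset.mem_filter.2 ⟨hx, hxy⟩) y (Finset.mem_filter.2 ⟨hy, rfl⟩)
  · have h₁ := hg.2 x hx y hy hxy
    have h₂ := hh.2 _ (hmem x hx).1 _ (hmem y hy).1
      (by rwa [(hmem x hx).2, (hmem y hy).2])
    rw [(hmem x hx).2, (hmem y hy).2] at h₂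
    exact ⟨h₁.1.trans h₂.1.symm, h₁.2.trans h₂.2.symm⟩

theorem partiallyWellOrderedOn_card_le_one :
    {A : Finset Point | A.card ≤ 1}.PartiallyWellOrderedOn Embeds := by
  rw [Set.partiallyWellOrderedOn_iff_exists_lt]
  intro f hf
  -- A set with at most one point is determined up to embedding by its set of colours.
  obtain ⟨m, n, hmn, heq⟩ :=
    Finite.exists_ne_map_eq_of_infinite fun n => (f n).image Point.colour
  wlog hlt : m < n generalizing m n
  · exact this n m hmn.symm heq.symm (lt_of_le_of_ne (not_lt.1 hlt) hmn.symm)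
  refine ⟨m, n, hlt, ?_⟩
  have hone : ∀ x ∈ f m, ∀ y ∈ f m, x = y := Finset.card_le_one.1 (hf m)
  have hex : ∀ x : Point, ∃ y : Point, x ∈ f m → y ∈ f n ∧ y.colour = x.colour := fun x => by
    by_cases hx : x ∈ f m
    · obtain ⟨y, hy⟩ := Finset.mem_image.1 (heq ▸ Finset.mem_image_of_mem Point.colour hx)
      exact ⟨y, fun _ => hy⟩
    · exact ⟨x, fun h => absurd h hx⟩
  choose φ hφ using hex
  exact ⟨φ, hφ, fun x hx y hy => by simp [hone x hx y hy]⟩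

/-- The proper subsets of the terms of a minimal bad sequence are well-quasi-ordered: a bad
sequence of them could be spliced into the given one to contradict minimality. -/
theorem partiallyWellOrderedOn_ssubset_of_isMinBadSeq {C : Set Permutation} {f : ℕ → Finset Point}
    (hf : Set.PartiallyWellOrderedOn.IsBadSeq Embeds (colouredClass C) f)
    (hmin : ∀ n, Set.PartiallyWellOrderedOn.IsMinBadSeq Embeds Finset.card (colouredClass C) n f) :
    {B | ∃ n, B ⊂ f n}.PartiallyWellOrderedOn Embeds := by
  rw [Set.PartiallyWellOrderedOn.iff_forall_not_isBadSeq]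
  rintro g ⟨hg, hbad⟩
  choose N hN using hg
  obtain ⟨k₀, hk₀⟩ : ∃ k₀, ∀ k, N k₀ ≤ N k := by
    obtain ⟨_, ⟨k, rfl⟩, hk⟩ := wellFounded_lt.has_min (Set.range N) (Set.range_nonempty N)
    exact ⟨k, fun j => not_lt.1 (hk _ ⟨j, rfl⟩)⟩
  refine hmin (N k₀) (fun n => if n < N k₀ then f n else g (k₀ + (n - N k₀)))
    (fun m hm => (if_pos hm).symm) ?_ ⟨fun n => ?_, fun m n hmn => ?_⟩
  · simpa using Finset.card_lt_card (hN k₀)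
  · dsimp only
    split_ifs
    exacts [hf.1 n, colouredClass_of_subset (hf.1 _) (hN _).subset]
  · dsimp only
    split_ifs with hm hn hn
    · exact hf.2 m n hmn
    · exact fun h => hf.2 m _ (hm.trans_le (hk₀ _))
        (_root_.trans h (embeds_of_subset (hN _).subset))
    · omega
    · exact hbad _ _ (by omega)

theorem partiallyWellOrderedOn_colouredClass {C : Set Permutation}
    (hfin : {π : Permutation | π ∈ C ∧ π.IsSimple}.Finite) :
    (colouredClass C).PartiallyWellOrderedOn Embeds := by
  classical
  rw [Set.PartiallyWellOrderedOn.iff_not_exists_isMinBadSeq Finset.card]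
  rintro ⟨f, hf, hmin⟩
  have hne : ∀ n, (f n).Nonempty := fun n => by
    rw [Finset.nonempty_iff_ne_empty]
    intro h
    refine hf.2 n (n + 1) n.lt_succ_self (embeds_of_subset ?_)
    simp [h]
  have hD := (partiallyWellOrderedOn_ssubset_of_isMinBadSeq hf hmin).union
    partiallyWellOrderedOn_card_le_one
  choose σ g hσ hg hblocks using fun n =>
    exists_simple_inflation (hf.1 n).1 (hf.1 n).2.1 (hne n)
  have := hfin.to_subtype
  obtain ⟨⟨τ, hτ⟩, hinf⟩ := Finite.exists_infinite_fiber
    (fun n => (⟨σ n, (hf.1 n).2.2 _ (hg n).isPattern, hσ n⟩ :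
      {π : Permutation | π ∈ C ∧ π.IsSimple}))
  have hinf' : {n | σ n = τ}.Infinite := by
    refine (Set.infinite_coe_iff.1 hinf).mono fun n hn => ?_
    exact congrArg Subtype.val hn
  -- Along the subsequence of terms with quotient `τ`, compare the tuples of blocks.
  have hτ' : ∀ n, ∃ h : Point → Fin τ.length,
      Inflates Point.index Point.value (f (Nat.nth (σ · = τ) n)) τ h ∧
      ∀ a, ((f (Nat.nth (σ · = τ) n)).filter fun x => h x = a) ⊂ f (Nat.nth (σ · = τ) n) ∨
        (f (Nat.nth (σ · = τ) n)).card ≤ 1 := fun n => by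
    have hn := Nat.nth_mem_of_infinite hinf' n
    generalize Nat.nth (σ · = τ) n = N at hn
    subst hn
    exact ⟨g N, hg N, hblocks N⟩
  choose h hh hhblocks using hτ'
  obtain ⟨m, n, hmn, hle⟩ := (Set.PartiallyWellOrderedOn.pi fun _ : Fin τ.length => hD).exists_lt
    (f := fun n a => (f (Nat.nth (σ · = τ) n)).filter fun x => h n x = a)
    fun n a _ => (hhblocks n a).imp (fun h' => ⟨_, h'⟩)
      fun h' => (Finset.card_filter_le _ _).trans h'
  exact hf.2 _ _ (Nat.nth_strictMono hinf' hmn) ((hh m).embeds (hh n) hle)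

/-! ### Basis elements as coloured permutations -/

theorem length_le_of_le {σ π : Permutation} (h : σ ≤ π) : σ.length ≤ π.length := by
  obtain ⟨f, hf, -⟩ := h
  simpa using Fintype.card_le_of_injective f hf.injective

theorem length_lt_of_lt {σ π : Permutation} (h : σ < π) : σ.length < π.length := by
  refine (length_le_of_le h.le).lt_of_ne fun hlen => h.not_ge ?_
  obtain ⟨m, σ⟩ := σ
  obtain ⟨n, π⟩ := π
  obtain ⟨f, hf, h⟩ := h.le
  dsimp only at f hf h hlen
  subst hlen
  have hid : f = id := (StrictMono.range_inj hf strictMono_id).mp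
    (by rw [(Finite.injective_iff_surjective.mp hf.injective).range_eq, Set.range_id])
  subst hid
  exact ⟨id, strictMono_id, fun i j => (h i j).symm⟩

instance : WellFoundedLT Permutation :=
  ⟨Subrelation.wf length_lt_of_lt (InvImage.wf length wellFounded_lt)⟩

open Classical in
/-- The `i`-th entry of `β`, coloured by whether it lies below the last entry. -/
noncomputable def entry (β : Permutation) (i : Fin β.length) : Point :=
  (i, β.toPerm i, decide (∃ k : Fin β.length, (k : ℕ) + 1 = β.length ∧ β.toPerm i < β.toPerm k))

open Classical in
/-- The coloured permutation obtained from `β` by deleting the last entry and colouring the others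
by whether they lie below it. -/
noncomputable def erasedLast (β : Permutation) : Finset Point :=
  (Finset.univ.filter fun i : Fin β.length => (i : ℕ) + 1 < β.length).image β.entry

theorem mem_erasedLast {β : Permutation} {x : Point} :
    x ∈ β.erasedLast ↔ ∃ i : Fin β.length, (i : ℕ) + 1 < β.length ∧ β.entry i = x := by
  simp [erasedLast]

theorem colour_entry {β : Permutation} (i : Fin β.length) {k : Fin β.length}
    (hk : (k : ℕ) + 1 = β.length) :
    (β.entry i).colour = true ↔ β.toPerm i < β.toPerm k := by
  simp only [entry, Point.colour, decide_eq_true_eq]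
  refine ⟨fun ⟨l, hl, h⟩ => ?_, fun h => ⟨k, hk, h⟩⟩
  obtain rfl : l = k := Fin.ext (by omega)
  exact h

theorem value_entry_lt {β : Permutation} (i j : Fin β.length) :
    (β.entry i).value < (β.entry j).value ↔ β.toPerm i < β.toPerm j :=
  Iff.rfl

theorem index_entry_lt {β : Permutation} (i j : Fin β.length) :
    (β.entry i).index < (β.entry j).index ↔ i < j :=
  Iff.rfl

/-- The colours carry enough information to put the last entries back. -/
theorem contains_of_embeds_erasedLast {β γ : Permutation} (hγ : 0 < γ.length)
    (h : Embeds β.erasedLast γ.erasedLast) : β ≤ γ := by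
  obtain ⟨φ, hφ, hφ'⟩ := h
  have hex : ∀ i : Fin β.length, ∃ j : Fin γ.length,
      ((i : ℕ) + 1 < β.length → (j : ℕ) + 1 < γ.length ∧ γ.entry j = φ (β.entry i)) ∧
      ((i : ℕ) + 1 = β.length → (j : ℕ) + 1 = γ.length) := fun i => by
    by_cases hi : (i : ℕ) + 1 < β.length
    · obtain ⟨j, hj⟩ := mem_erasedLast.1 (hφ _ (mem_erasedLast.2 ⟨i, hi, rfl⟩)).1
      exact ⟨j, fun _ => hj, fun h => absurd h hi.ne⟩
    · exact ⟨⟨γ.length - 1, by omega⟩, fun h => absurd h hi, fun _ => by simp only; omega⟩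
  choose f hf hflast using hex
  have hcolour : ∀ i k : Fin β.length, (i : ℕ) + 1 < β.length → (k : ℕ) + 1 = β.length →
      (β.toPerm i < β.toPerm k ↔ γ.toPerm (f i) < γ.toPerm (f k)) := fun i k hi hk => by
    rw [← colour_entry i hk, ← colour_entry (f i) (hflast k hk), (hf i hi).2,
      (hφ _ (mem_erasedLast.2 ⟨i, hi, rfl⟩)).2]
  have key : ∀ i j : Fin β.length, (i < j ↔ f i < f j) ∧
      (β.toPerm i < β.toPerm j ↔ γ.toPerm (f i) < γ.toPerm (f j)) := fun i j => by
    rcases Nat.lt_or_eq_of_le (Nat.succ_le_of_lt i.2) with hi | hi <;>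
      rcases Nat.lt_or_eq_of_le (Nat.succ_le_of_lt j.2) with hj | hj
    · have := hφ' _ (mem_erasedLast.2 ⟨i, hi, rfl⟩) _ (mem_erasedLast.2 ⟨j, hj, rfl⟩)
      rw [← (hf i hi).2, ← (hf j hj).2] at this
      exact this
    · have h₁ := (hf i hi).1
      have h₂ := hflast j hj
      refine ⟨?_, hcolour i j hi hj⟩
      simp only [Fin.lt_def]
      omega
    · have h₁ := (hf j hj).1
      have h₂ := hflast i hi
      have hne : j ≠ i := fun h => by subst h; omega
      have hne' : f j ≠ f i := fun h => by rw [h] at h₁; omega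
      refine ⟨by simp only [Fin.lt_def]; omega, ?_⟩
      have := not_congr (hcolour j i hj hi)
      rwa [not_lt, not_lt, le_iff_lt_or_eq, le_iff_lt_or_eq,
        or_iff_left (fun h => hne (β.toPerm.injective h).symm),
        or_iff_left (fun h => hne' (γ.toPerm.injective h).symm)] at this
    · obtain rfl : i = j := Fin.ext (by omega)
      simp
  exact ⟨f, fun i j => (key i j).1.1, fun i j => (key i j).2⟩

theorem erasedLast_mem_colouredClass {C : Set Permutation} {β : Permutation} (hβ : 0 < β.length)
    (hmin : ∀ σ < β, σ ∈ C) : β.erasedLast ∈ colouredClass C := by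
  refine ⟨fun x hx y hy h => ?_, fun x hx y hy h => ?_, fun σ ⟨e, heA, hei, hev⟩ => ?_⟩
  · obtain ⟨i, -, rfl⟩ := mem_erasedLast.1 hx
    obtain ⟨j, -, rfl⟩ := mem_erasedLast.1 hy
    exact congrArg _ (Fin.ext h)
  · obtain ⟨i, -, rfl⟩ := mem_erasedLast.1 hx
    obtain ⟨j, -, rfl⟩ := mem_erasedLast.1 hy
    exact congrArg _ (β.toPerm.injective (Fin.ext h))
  · choose f hf hfe using fun a => mem_erasedLast.1 (heA a)
    have hle : σ ≤ β := by
      refine ⟨f, fun a b hab => ?_, fun a b => ?_⟩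
      · rwa [hei, ← hfe, ← hfe, index_entry_lt] at hab
      · rw [hev, ← hfe, ← hfe, value_entry_lt]
    refine hmin σ (hle.lt_of_ne ?_)
    rintro rfl
    -- The image of `f` misses the last index, so `f` is not surjective.
    have hinj : Function.Injective f := fun a b hab =>
      injective_of_lt_iff hei (by rw [← hfe, ← hfe, hab])
    obtain ⟨a, ha⟩ := Finite.surjective_of_injective hinj ⟨σ.length - 1, by omega⟩
    have := hf a
    rw [ha] at this
    simp only at this
    omega

/-- The basis of a class consists of the minimal permutations outside it. -/
theorem isBasis_minimal {C : Set Permutation} (hC : IsClass C) :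
    IsBasis {β | Minimal (· ∉ C) β} C := by
  refine ⟨Set.ext fun π => ⟨fun hπ β (hβ : Minimal (· ∉ C) β) hle =>
    hβ.prop (hC π hπ β hle), fun hπ => ?_⟩, ?_⟩
  · by_contra hπC
    obtain ⟨β, hle, hβ⟩ := exists_minimal_le_of_wellFoundedLT (· ∉ C) π hπC
    exact hπ β hβ hle
  · rintro B rfl β (hβ : Minimal (· ∉ Av B) β)
    have hβB := hβ.prop
    simp only [Av, Set.mem_ofPred_eq] at hβB
    push Not at hβB
    obtain ⟨γ, hγ, hle⟩ := hβB
    have := hβ.eq_of_le (y := γ) (fun h => h γ hγ le_rfl) hle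
    exact this ▸ hγ

theorem finite_minimal_notMem {C : Set Permutation}
    (hfin : {π : Permutation | π ∈ C ∧ π.IsSimple}.Finite) :
    {β | Minimal (· ∉ C) β}.Finite := by
  have hzero : {β : Permutation | β.length = 0}.Finite := by
    refine Set.Subsingleton.finite ?_
    rintro ⟨_, σ⟩ rfl ⟨_, τ⟩ rfl
    exact congrArg _ (Subsingleton.elim σ τ)
  have hpos : {β : Permutation | Minimal (· ∉ C) β ∧ 0 < β.length}.Finite := by
    by_contra hinf
    have f := Set.Infinite.natEmbedding _ hinf
    obtain ⟨m, n, hmn, h⟩ := (partiallyWellOrderedOn_colouredClass hfin).exists_lt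
      (f := fun n => (f n).1.erasedLast) fun n =>
        erasedLast_mem_colouredClass (f n).2.2 fun σ hσ => by
          by_contra hσC
          exact (f n).2.1.not_lt hσC hσ
    have hle := contains_of_embeds_erasedLast (f n).2.2 h
    have heq := (f n).2.1.eq_of_le (f m).2.1.prop hle
    exact hmn.ne (f.injective (Subtype.ext heq))
  refine (hpos.union hzero).subset fun β hβ => ?_
  rcases Nat.eq_zero_or_pos β.length with h | h
  exacts [Or.inr h, Or.inl ⟨hβ, h⟩]

end Permutation

theorem mainTheorem2 (C : Set Permutation) (hC : Permutation.IsClass C)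
    (hfin : {π : Permutation | π ∈ C ∧ π.IsSimple}.Finite) :
    Permutation.FinitelyBased C :=
  ⟨_, Permutation.isBasis_minimal hC, Permutation.finite_minimal_notMem hfin⟩
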